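/- Let $\mathbb T=\mathbb R/(2\pi\mathbb Z)$, let $\mathcal H$ be the periodic Hilbert transform, $\widehat{(\mathcal H u)}_k=-i\,\mathrm{sgn}(k)\,\hat u_k$ for $k\in\mathbb Z$ (with $\mathrm{sgn}(0)=0$), and let $H^0_0(\mathbb T)$ be the space of real-valued $u\in L^2(\mathbb T)$ with $\frac1{2\pi}\int_{\mathbb T}u\,dx=0$. Let $\alpha\in\mathbb R$, $\varepsilon\ge 0$, $T>0$, $0\le a<b\le 2\pi$, let $c\in L^2(0,T)$ be real-valued, and let $u\in L^2(0,T;H^0_0(\mathbb T))$ be such that $$u_t+(\mathcal H-\varepsilon)u_{xx}+\alpha\,u u_x=0\quad\text{in }\mathbb T\times(0,T)$$ in the sense of distributions, where $uu_x$ stands for $(u^2/2)_x$, and $$u(x,t)=c(t)\quad\text{for a.e. }(x,t)\in(a,b)\times(0,T).$$ Then $u(x,t)=0$ for a.e. $(x,t)\in\mathbb T\times(0,T)$. -/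

import Mathlib

open MeasureTheory Set
open scoped Real ContDiff

noncomputable section

namespace BenjaminOno

/-- The periodic domain `ℝ / (2πℤ)`. Its `volume` is Lebesgue measure, of total mass `2π`. -/
abbrev Torus : Type := AddCircle (2 * π)

instance : Fact (0 < 2 * π) := ⟨Real.two_pi_pos⟩

/-- `f ∈ H⁰₀(𝕋)`: a real-valued square-integrable function on the torus with zero mean. -/
def MemHZeroZero (f : Torus → ℝ) : Prop :=
  MemLp f 2 volume ∧ (1 / (2 * π)) * ∫ x, f x = 0

/-- `u ∈ L²(0,T; H⁰₀(𝕋))`, for a function `u = u(x,t)`: `u` is measurable on `𝕋 × (0,T)`,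
`u(·,t) ∈ H⁰₀(𝕋)` for a.e. `t ∈ (0,T)`, and `∫₀ᵀ ‖u(·,t)‖² dt < ∞`. -/
structure MemL2HZeroZero (T : ℝ) (u : Torus → ℝ → ℝ) : Prop where
  aestronglyMeasurable : AEStronglyMeasurable (fun p : Torus × ℝ => u p.1 p.2)
    (volume.prod (volume.restrict (Ioo 0 T)))
  memHZeroZero : ∀ᵐ t ∂(volume.restrict (Ioo 0 T)), MemHZeroZero (fun x => u x t)
  lintegral_lt_top :
    ∫⁻ t in Ioo 0 T, (eLpNorm (fun x => u x t) 2 (volume : Measure Torus)) ^ 2 < ⊤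

/-- The Hilbert transform on `L²(𝕋)`: the function in `L²(𝕋)` with Fourier series
`∑ k, (-i sgn(k)) f̂_k e^{ikx}`, where `f̂_k = (1/2π) ∫ f(x) e^{-ikx} dx`
(the normalisation of `fourierCoeff`); the series converges in `L²`. -/
def hilbert (f : Torus → ℂ) : Lp ℂ 2 (AddCircle.haarAddCircle (T := 2 * π)) :=
  ∑' k : ℤ, (-Complex.I * (Int.sign k : ℂ) * fourierCoeff f k) • fourierLp 2 k

/-- The Fourier coefficients of the Hilbert transform of a square-integrable function. -/
theorem fourierCoeff_hilbert {f : Torus → ℂ} (hf : MemLp f 2 AddCircle.haarAddCircle) (k : ℤ) :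
    fourierCoeff (hilbert f) k = -Complex.I * (Int.sign k : ℂ) * fourierCoeff f k := by
  have hc : Memℓp (fun k : ℤ => fourierCoeff f k) 2 := by
    have h := lp.memℓp (fourierBasis.repr (hf.toLp f))
    have e : (fun k : ℤ => fourierCoeff f k) = fun k => fourierBasis.repr (hf.toLp f) k := by
      funext n
      rw [fourierBasis_repr]
      exact integral_congr_ae (hf.coeFn_toLp.symm.mono fun x hx => by simp [hx])
    rw [e]
    exact h
  have hm : Memℓp (fun k : ℤ => -Complex.I * (Int.sign k : ℂ) * fourierCoeff f k) 2 := by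
    refine hc.mono' fun n => ?_
    rcases lt_trichotomy n 0 with h | h | h
    · simp [Int.sign_eq_neg_one_of_neg h]
    · simp [h]
    · simp [Int.sign_eq_one_of_pos h]
  have hs : hilbert f = fourierBasis.repr.symm ⟨_, hm⟩ := by
    have h := (fourierBasis (T := 2 * π)).hasSum_repr_symm ⟨_, hm⟩
    simp only [coe_fourierBasis] at h
    exact h.tsum_eq
  rw [← fourierBasis_repr, hs, LinearIsometryEquiv.apply_symm_apply]

/-- The derivative along the circle. -/
def circleDeriv (f : Torus → ℂ) (x : Torus) : ℂ :=
  deriv (fun y : ℝ => f (x + (y : Torus))) 0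

/-- Test functions on `𝕋 × (0,T)`: smooth, with compact support in `𝕋 × (0,T)`. -/
structure IsTestFunction (T : ℝ) (φ : Torus → ℝ → ℂ) : Prop where
  contDiff : ContDiff ℝ ∞ (fun p : ℝ × ℝ => φ (p.1 : Torus) p.2)
  compact_support : ∃ K : Set ℝ, IsCompact K ∧ K ⊆ Ioo 0 T ∧ ∀ x, ∀ t ∉ K, φ x t = 0

/-- `u_t + (H - ε) u_xx + α u u_x = 0` in the sense of distributions on `𝕋 × (0,T)`, for `u` in
`L²(0,T; L²(𝕋))`, where `u u_x` is `(u²/2)_x` and `H u_xx = (H u)_xx`: all derivatives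
are transferred to the test function. -/
def IsDistribSolution (α ε T : ℝ) (u : Torus → ℝ → ℝ) : Prop :=
  ∀ φ : Torus → ℝ → ℂ, IsTestFunction T φ →
    ∫ t in Ioo 0 T, ∫ x : Torus,
      (-(u x t : ℂ) * deriv (φ x) t
        + (hilbert (fun y => (u y t : ℂ)) x - (ε : ℂ) * (u x t : ℂ))
          * circleDeriv (circleDeriv (fun y => φ y t)) x
        - (α : ℂ) * ((u x t : ℂ) ^ 2 / 2) * circleDeriv (fun y => φ y t) x) = 0

end BenjaminOno

end

/-! Fix a smooth `g` supported in a short arc and test the equation with `η(t) g'(x - y)`, where the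
translated support stays in `(a,b)`. There `u = c(t)`, so every local term is a function of `t`
times the integral of a derivative of `g`, and vanishes. What survives is `∫ Hu · g'''(x - y) dx =
0` for a.e. `t` (`ae_integral_hilbert_mul_eq_zero`), and likewise `∫ u · g'''(x - y) dx = 0`.

Hence `u + iHu`, which for mean zero is twice the positive-frequency part of `u`, is orthogonal to
`g'''(· - y)` for an interval of `y`. By Parseval this says that a power series in `e^{iy}` with
coefficients `û_k (g''')^_{-k}` vanishes on an arc of the unit circle. The coefficients are
absolutely summable, so boundary uniqueness (`eq_zero_of_tsum_mul_pow_eq_zero_on_arc`) makes them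
all zero.

For each `k > 0` a narrow enough bump has nonzero `-k`-th coefficient, so `û_k = 0`. Negative
frequencies follow because `u` is real. -/

/-! ### Boundary uniqueness for power series. -/

open Filter Topology in
/-- A power series with absolutely summable coefficients which vanishes on an arc of the unit
circle is zero. -/
theorem eq_zero_of_tsum_mul_pow_eq_zero_on_arc {c : ℕ → ℂ} (hc : Summable fun k => ‖c k‖)
    {s t : ℝ} (hst : s < t)
    (h : ∀ x ∈ Ioo s t, ∑' k, c k * Complex.exp (x * Complex.I) ^ k = 0) (k : ℕ) : c k = 0 := by
  set G : ℂ → ℂ := fun z => ∑' k, c k * z ^ k with hG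
  have bound : ∀ (i : ℕ) (z : ℂ), z ∈ Metric.closedBall (0 : ℂ) 1 → ‖c i * z ^ i‖ ≤ ‖c i‖ := by
    intro i z hz
    rw [norm_mul, norm_pow]
    exact mul_le_of_le_one_right (norm_nonneg _) (pow_le_one₀ (norm_nonneg _) (by simpa using hz))
  have hcont : ContinuousOn G (Metric.closedBall 0 1) :=
    continuousOn_tsum (fun i => by fun_prop) hc bound
  have hdiff : DifferentiableOn ℂ G (Metric.ball 0 1) :=
    Complex.differentiableOn_tsum_of_summable_norm hc (fun i => by fun_prop) Metric.isOpen_ball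
      fun i z hz => bound i z (Metric.ball_subset_closedBall hz)
  have hser : HasFPowerSeriesAt G (FormalMultilinearSeries.ofScalars ℂ c) 0 := by
    rw [hasFPowerSeriesAt_iff]
    filter_upwards [Metric.closedBall_mem_nhds (0 : ℂ) one_pos] with z hz
    have := (Summable.of_norm_bounded hc fun i => bound i z hz).hasSum
    simpa [FormalMultilinearSeries.coeff_ofScalars, mul_comm, hG] using this
  suffices hz : ∀ᶠ z in 𝓝 0, G z = 0 by
    have h0 := (hser.congr hz).eq_zero
    have := congrArg (fun p => FormalMultilinearSeries.coeff p k) h0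
    rw [FormalMultilinearSeries.coeff_ofScalars] at this
    simpa [FormalMultilinearSeries.coeff] using this
  refine hser.analyticAt.eventually_eq_zero_or_eventually_ne_zero.resolve_right fun hne => ?_
  -- `N` is so large that every orbit of the rotation by `2π/N` meets the arc. The product of the
  -- `N` rotated copies of `G` then vanishes on the whole circle, hence on the disc by the maximum
  -- principle.
  obtain ⟨N, hN⟩ := exists_nat_gt (2 * π / (t - s))
  have hts : 0 < t - s := sub_pos.2 hst
  have hN0 : (0 : ℝ) < N := lt_trans (by positivity) hN
  have hN0' : (N : ℂ) ≠ 0 := by exact_mod_cast hN0.ne'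
  have hNs : 2 * π / N < t - s := by
    rw [div_lt_iff₀ hts] at hN
    rw [div_lt_iff₀ hN0]; linarith
  set ζ : ℂ := Complex.exp ((2 * π / N : ℝ) * Complex.I) with hζ
  have hζn : ‖ζ‖ = 1 := Complex.norm_exp_ofReal_mul_I _
  have hζ0 : ζ ≠ 0 := Complex.exp_ne_zero _
  have hζN : ζ ^ N = 1 := by
    rw [hζ, ← Complex.exp_nat_mul, ← Complex.exp_two_pi_mul_I]
    congr 1; push_cast; field_simp
  have hmem : ∀ j : ℕ, ∀ z : ℂ, ‖ζ ^ j * z‖ = ‖z‖ := fun j z => by simp [hζn]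
  set P : ℂ → ℂ := fun z => ∏ j ∈ Finset.range N, G (ζ ^ j * z) with hP
  have hPd : DiffContOnCl ℂ P (Metric.ball 0 1) := by
    refine ⟨DifferentiableOn.fun_finsetProd fun j _ => ?_, ?_⟩
    · exact hdiff.comp (by fun_prop) fun z hz => by
        simpa [hζn] using hz
    · rw [closure_ball _ one_ne_zero]
      refine continuousOn_finsetProd _ fun j _ => ?_
      exact hcont.comp (by fun_prop) fun z hz => by simpa [hζn] using hz
  have hP0 : EqOn P 0 (Metric.ball 0 1) := by
    refine Complex.eqOn_of_eqOn_frontier Metric.isBounded_ball hPd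
      (differentiable_const (0 : ℂ)).diffContOnCl fun z hz => ?_
    rw [frontier_ball _ one_ne_zero, mem_sphere_zero_iff_norm] at hz
    obtain ⟨α, rfl⟩ : ∃ α : ℝ, Complex.exp (α * Complex.I) = z := Complex.norm_eq_one_iff z |>.1 hz
    -- The least `n` with `α + n(2π/N) > s`; the point reached is at most `s + 2π/N < t`.
    set n : ℤ := ⌊(s - α) * N / (2 * π)⌋ + 1 with hn
    have hlt : (s - α) * N / (2 * π) < n := by rw [hn]; push_cast; exact Int.lt_floor_add_one _
    have hle : (n : ℝ) ≤ (s - α) * N / (2 * π) + 1 := by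
      rw [hn]; push_cast; gcongr; exact Int.floor_le _
    have hx : α + n * (2 * π / N) ∈ Ioo s t := by
      have e : (s - α) * N / (2 * π) * (2 * π / N) = s - α := by field_simp
      have h1 := mul_lt_mul_of_pos_right hlt (show 0 < 2 * π / N by positivity)
      have h2 := mul_le_mul_of_nonneg_right hle (show 0 ≤ 2 * π / N by positivity)
      rw [add_mul, e] at h2
      rw [e] at h1
      constructor <;> linarith
    have hNz : (N : ℤ) ≠ 0 := by exact_mod_cast hN0.ne'
    have hmod : ζ ^ (n % N).toNat = ζ ^ n := by
      rw [← zpow_natCast, Int.toNat_of_nonneg (Int.emod_nonneg _ hNz)]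
      conv_rhs => rw [← Int.emod_add_mul_ediv n N, zpow_add₀ hζ0, zpow_mul, zpow_natCast, hζN]
      simp
    refine Finset.prod_eq_zero (i := (n % N).toNat) ?_ ?_
    · have := Int.emod_lt_of_pos n (show (0 : ℤ) < N by exact_mod_cast hN0)
      have := Int.emod_nonneg n hNz
      rw [Finset.mem_range]; omega
    · have e : ζ ^ n * Complex.exp (α * Complex.I)
          = Complex.exp ((α + n * (2 * π / N) : ℝ) * Complex.I) := by
        rw [hζ, ← Complex.exp_int_mul, ← Complex.exp_add]
        congr 1
        push_cast; ring
      rw [hmod, e]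
      exact h _ hx
  -- If `G` had no zeros in a punctured neighbourhood of `0`, neither would the finite product `P`,
  -- contradicting `hP0`.
  have hev : ∀ᶠ z in 𝓝[≠] (0 : ℂ), ∀ j ∈ Finset.range N, G (ζ ^ j * z) ≠ 0 := by
    rw [Finset.eventually_all]
    intro j _
    have htend : Tendsto (fun z : ℂ => ζ ^ j * z) (𝓝[≠] 0) (𝓝[≠] 0) := by
      refine tendsto_nhdsWithin_iff.2 ⟨?_, ?_⟩
      · have : Tendsto (fun z : ℂ => ζ ^ j * z) (𝓝 0) (𝓝 (ζ ^ j * 0)) :=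
          (continuous_const.mul continuous_id).tendsto _
        rw [mul_zero] at this
        exact this.mono_left nhdsWithin_le_nhds
      · filter_upwards [self_mem_nhdsWithin] with z hz
        exact mul_ne_zero (pow_ne_zero _ hζ0) hz
    exact htend.eventually hne
  obtain ⟨z, hz1, hz2⟩ :=
    (hev.and (nhdsWithin_le_nhds (Metric.ball_mem_nhds (0 : ℂ) one_pos))).exists
  exact Finset.prod_ne_zero_iff.2 hz1 (hP0 hz2)

/-! ### Fourier series on the circle. -/

namespace AddCircle

variable {T : ℝ} [hT : Fact (0 < T)]

theorem fourierCoeff_conj (f : AddCircle T → ℂ) (k : ℤ) :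
    fourierCoeff (fun x => (starRingEnd ℂ) (f x)) k = (starRingEnd ℂ) (fourierCoeff f (-k)) := by
  rw [fourierCoeff, fourierCoeff, ← integral_conj]
  congr 1
  ext x
  simp only [smul_eq_mul, map_mul, neg_neg]
  rw [fourier_neg]

theorem fourierCoeff_toLp_two {f : AddCircle T → ℂ} (hf : MemLp f 2 haarAddCircle) (k : ℤ) :
    fourierCoeff (hf.toLp f) k = fourierCoeff f k :=
  integral_congr_ae (hf.coeFn_toLp.mono fun x hx => by simp [hx])

theorem memLp_conj {f : AddCircle T → ℂ} (hf : MemLp f 2 haarAddCircle) :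
    MemLp (fun x => (starRingEnd ℂ) (f x)) 2 haarAddCircle := hf.star

/-- **Parseval's identity** in bilinear form. -/
theorem hasSum_fourierCoeff_mul_fourierCoeff_neg {f g : AddCircle T → ℂ}
    (hf : MemLp f 2 haarAddCircle) (hg : MemLp g 2 haarAddCircle) :
    HasSum (fun k => fourierCoeff f k * fourierCoeff g (-k))
      (∫ x, f x * g x ∂haarAddCircle) := by
  have hg' := memLp_conj hg
  have h := (fourierBasis (T := T)).hasSum_inner_mul_inner (hg'.toLp _) (hf.toLp f)
  convert! h using 1
  · ext k
    rw [← inner_conj_symm, ← HilbertBasis.repr_apply_apply, ← HilbertBasis.repr_apply_apply,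
      fourierBasis_repr, fourierBasis_repr, fourierCoeff_toLp_two, fourierCoeff_toLp_two,
      fourierCoeff_conj, Complex.conj_conj, mul_comm]
  · rw [L2.inner_def]
    refine integral_congr_ae ?_
    filter_upwards [hf.coeFn_toLp, hg'.coeFn_toLp] with x h1 h2
    rw [h1, h2]
    simp [RCLike.inner_apply]

theorem summable_norm_fourierCoeff_mul {f g : AddCircle T → ℂ}
    (hf : MemLp f 2 haarAddCircle) (hg : MemLp g 2 haarAddCircle) :
    Summable fun k => ‖fourierCoeff f k * fourierCoeff g (-k)‖ :=
  (hasSum_fourierCoeff_mul_fourierCoeff_neg hf hg).summable.norm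

theorem ae_eq_zero_of_fourierCoeff_eq_zero {f : AddCircle T → ℂ} (hf : MemLp f 2 haarAddCircle)
    (h : ∀ k, fourierCoeff f k = 0) : f =ᵐ[haarAddCircle] 0 := by
  have h0 : hf.toLp f = 0 := by
    apply (fourierBasis (T := T)).repr.injective
    ext k
    rw [fourierBasis_repr, fourierCoeff_toLp_two, h k]
    simp
  exact (hf.coeFn_toLp.symm.trans (h0 ▸ Lp.coeFn_zero _ _ _))

theorem fourierCoeff_comp_sub (f : AddCircle T → ℂ) (y : AddCircle T) (k : ℤ) :
    fourierCoeff (fun x => f (x - y)) k = fourier (-k) y * fourierCoeff f k := by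
  rw [fourierCoeff, fourierCoeff,
    ← integral_add_right_eq_self (fun x => fourier (-k) x • f (x - y)) y,
    ← integral_const_mul]
  congr 1
  ext x
  simp only [fourier_apply, smul_add, toCircle_add, add_sub_cancel_right, smul_eq_mul,
    Circle.coe_mul]
  ring

/-- Almost every point of the circle has a property if almost every representative in a
fundamental interval has it. -/
theorem ae_of_ae_restrict_Ioc (a : ℝ) {p : AddCircle T → Prop}
    (h : ∀ᵐ x : ℝ ∂(volume.restrict (Ioc a (a + T))), p (x : AddCircle T)) :
    ∀ᵐ X : AddCircle T, p X := by
  have h1 := (measurePreserving_equivIoc T (a := a)).quasiMeasurePreserving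
  rw [ae_restrict_iff' measurableSet_Ioc] at h
  have h2 : ∀ᵐ x : Ioc a (a + T) ∂(Measure.comap Subtype.val volume),
      p ((x : ℝ) : AddCircle T) := by
    rw [← ae_restrict_iff_subtype measurableSet_Ioc (p := fun x : ℝ => p (x : AddCircle T)),
      ae_restrict_iff' measurableSet_Ioc]
    exact h
  filter_upwards [h1.ae h2] with x hx
  simpa using hx

end AddCircle

namespace BenjaminOno
open AddCircle

/-- Bilinear Parseval pairs `k` with `-k`, and the multiplier `-i sgn k` is odd. -/
theorem integral_hilbert_mul {f g : Torus → ℂ} (hf : MemLp f 2 haarAddCircle)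
    (hg : MemLp g 2 haarAddCircle) :
    ∫ x, hilbert f x * g x ∂haarAddCircle = -∫ x, f x * hilbert g x ∂haarAddCircle := by
  have h1 := hasSum_fourierCoeff_mul_fourierCoeff_neg (Lp.memLp (hilbert f)) hg
  have h2 := (hasSum_fourierCoeff_mul_fourierCoeff_neg hf (Lp.memLp (hilbert g))).neg
  refine h1.unique ?_
  convert! h2 using 2 with k
  rw [fourierCoeff_hilbert hf, fourierCoeff_hilbert hg, Int.sign_neg]
  push_cast
  ring

end BenjaminOno

/-! ### Smooth functions and bumps on the circle. -/

namespace BenjaminOno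
open AddCircle Topology

/-- Smoothness of a function on the circle, through its lift to the line. -/
def SmoothOnTorus (f : Torus → ℂ) : Prop := ContDiff ℝ ∞ fun x : ℝ => f (x : Torus)

theorem circleDeriv_coe (f : Torus → ℂ) (x : ℝ) :
    circleDeriv f (x : Torus) = deriv (fun y : ℝ => f (y : Torus)) x := by
  have h := deriv_comp_const_add (f := fun y : ℝ => f (y : Torus)) x 0
  rw [add_zero] at h
  rw [← h, circleDeriv]
  simp only [coe_add]

theorem circleDeriv_comp_sub (f : Torus → ℂ) (y : Torus) :
    circleDeriv (fun x => f (x - y)) = fun x => circleDeriv f (x - y) := by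
  ext x
  simp only [circleDeriv, add_sub_right_comm]

theorem circleDeriv_const_mul (c : ℂ) (f : Torus → ℂ) :
    circleDeriv (fun x => c * f x) = fun x => c * circleDeriv f x := by
  ext x
  simp only [circleDeriv, deriv_const_mul_field]

theorem SmoothOnTorus.circleDeriv {f : Torus → ℂ} (hf : SmoothOnTorus f) :
    SmoothOnTorus (circleDeriv f) := by
  unfold SmoothOnTorus
  simp only [circleDeriv_coe]
  exact (contDiff_infty_iff_deriv.1 hf).2

theorem SmoothOnTorus.continuous {f : Torus → ℂ} (hf : SmoothOnTorus f) : Continuous f :=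
  QuotientAddGroup.isOpenQuotientMap_mk.isQuotientMap.continuous_iff.2 (ContDiff.continuous hf)

theorem SmoothOnTorus.comp_sub {f : Torus → ℂ} (hf : SmoothOnTorus f) (y : ℝ) :
    SmoothOnTorus fun x => f (x - (y : Torus)) := by
  have h : ContDiff ℝ ∞ fun x : ℝ => f ((x - y : ℝ) : Torus) :=
    ContDiff.comp (g := fun x : ℝ => f (x : Torus)) hf (contDiff_id.sub contDiff_const)
  exact h

theorem SmoothOnTorus.memLp {f : Torus → ℂ} (hf : SmoothOnTorus f) :
    MemLp f 2 haarAddCircle :=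
  hf.continuous.memLp_of_hasCompactSupport (HasCompactSupport.of_compactSpace _)

theorem fourierCoeff_circleDeriv {f : Torus → ℂ} (hf : SmoothOnTorus f) (k : ℤ) :
    fourierCoeff (circleDeriv f) k = Complex.I * k * fourierCoeff f k := by
  rw [fourierCoeff_eq_intervalIntegral _ k 0, fourierCoeff_eq_intervalIntegral _ k 0]
  have hd : ∀ x : ℝ, HasDerivAt (fun y : ℝ => f (y : Torus)) (circleDeriv f (x : Torus)) x := by
    intro x
    rw [circleDeriv_coe]
    exact ((ContDiff.differentiable hf (by simp)) x).hasDerivAt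
  have h := intervalIntegral.integral_mul_deriv_eq_deriv_mul (a := 0) (b := 0 + 2 * π)
    (fun x _ => hasDerivAt_fourier_neg (2 * π) k x) (fun x _ => hd x)
    (Continuous.intervalIntegrable (by fun_prop) _ _)
    (Continuous.intervalIntegrable (ContDiff.continuous hf.circleDeriv) _ _)
  simp only [smul_eq_mul]
  rw [h, zero_add, coe_period, coe_zero, sub_self, zero_sub]
  simp only [mul_assoc, intervalIntegral.integral_const_mul]
  have : (π : ℂ) ≠ 0 := by exact_mod_cast Real.pi_ne_zero
  simp only [Complex.real_smul]
  push_cast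
  field_simp

theorem circleDeriv_eq_zero_of_notMem {f : Torus → ℂ} {S : Set Torus} (hS : IsClosed S)
    (hf : ∀ x ∉ S, f x = 0) : ∀ x ∉ S, circleDeriv f x = 0 := by
  intro x hx
  have hcont : ContinuousAt (fun y : ℝ => x + (y : Torus)) 0 :=
    (continuous_const.add (AddCircle.continuous_mk' _)).continuousAt
  have : (fun y : ℝ => f (x + (y : Torus))) =ᶠ[𝓝 0] fun _ => 0 := by
    filter_upwards [hcont.eventually (hS.isOpen_compl.mem_nhds (by simpa using hx))] with y hy
    exact hf _ hy
  rw [circleDeriv, this.deriv_eq, deriv_const]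

theorem fourier_coe_two_pi (k : ℤ) (x : ℝ) :
    fourier k (x : Torus) = Complex.exp ((k * x : ℝ) * Complex.I) := by
  rw [fourier_coe_apply]
  have : (π : ℂ) ≠ 0 := by exact_mod_cast Real.pi_ne_zero
  congr 1
  push_cast
  field_simp

/-- A smooth nonnegative function on the circle, positive exactly on the arc of radius `δ`
about `0`. -/
noncomputable def arcBump (δ : ℝ) (x : Torus) : ℂ := (expNegInvGlue ((fourier 1 x).re - Real.cos δ) : ℝ)

/-- The closed arc of radius `δ` about `0`. -/
def closedArc (δ : ℝ) : Set Torus := {x | Real.cos δ ≤ (fourier 1 x).re}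

theorem isClosed_closedArc (δ : ℝ) : IsClosed (closedArc δ) :=
  isClosed_le continuous_const (by fun_prop)

theorem re_fourier_one_coe (x : ℝ) : (fourier 1 (x : Torus)).re = Real.cos x := by
  rw [fourier_coe_two_pi, Complex.exp_ofReal_mul_I_re]; simp

theorem exists_mem_closedArc {δ : ℝ} (h0 : 0 ≤ δ) {X : Torus} (hX : X ∈ closedArc δ) :
    ∃ x : ℝ, |x| ≤ δ ∧ (x : Torus) = X := by
  obtain ⟨x, hx, rfl⟩ : ∃ x ∈ Ioc (-π) (-π + 2 * π), (x : Torus) = X :=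
    ⟨_, (equivIoc (2 * π) (-π) X).2, coe_equivIoc⟩
  refine ⟨x, ?_, rfl⟩
  rw [closedArc, mem_ofPred_eq, re_fourier_one_coe, ← Real.cos_abs x] at hX
  by_contra! hlt
  exact absurd hX (not_le.2 (Real.cos_lt_cos_of_nonneg_of_le_pi h0
    (abs_le.2 ⟨hx.1.le, by linarith [hx.2]⟩) hlt))

theorem arcBump_smooth (δ : ℝ) : SmoothOnTorus (arcBump δ) := by
  unfold SmoothOnTorus arcBump
  simp only [re_fourier_one_coe]
  exact Complex.ofRealCLM.contDiff.comp
    (expNegInvGlue.contDiff.comp (Real.contDiff_cos.sub contDiff_const))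

theorem arcBump_eq_zero {δ : ℝ} {x : Torus} (hx : x ∉ closedArc δ) : arcBump δ x = 0 := by
  rw [arcBump, expNegInvGlue.zero_of_nonpos, Complex.ofReal_zero]
  rw [closedArc, mem_ofPred_eq, not_le] at hx
  linarith

/-- The real part of the coefficient is the mean of `cos(kx)` times the bump. On the support `|kx| ≤
π/2`, so the integrand is nonnegative, and it is positive at `0`. -/
theorem fourierCoeff_arcBump_ne_zero {δ : ℝ} (h0 : 0 < δ) (hδ : δ ≤ π) {k : ℤ}
    (hk : |(k : ℝ)| * δ ≤ π / 2) : fourierCoeff (arcBump δ) k ≠ 0 := by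
  intro h
  have hc : Continuous fun x : Torus => fourier (-k) x • arcBump δ x :=
    (map_continuous (fourier (T := 2 * π) (-k))).smul (arcBump_smooth δ).continuous
  have hre : ∫ x : Torus, (fourier (-k) x • arcBump δ x).re ∂haarAddCircle = 0 := by
    have := Complex.reCLM.integral_comp_comm
      (hc.integrable_of_hasCompactSupport (HasCompactSupport.of_compactSpace _) (μ := haarAddCircle))
    simp only [Complex.reCLM_apply] at this
    rw [this]
    rw [fourierCoeff] at h
    rw [h, Complex.zero_re]
  refine hre.not_gt (Continuous.integral_pos_of_hasCompactSupport_nonneg_nonzero (x := 0)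
    (Complex.continuous_re.comp hc) (HasCompactSupport.of_compactSpace _) ?_ ?_)
  · intro X
    by_cases hX : X ∈ closedArc δ
    · obtain ⟨x, hx, rfl⟩ := exists_mem_closedArc h0.le hX
      simp only [Pi.zero_apply, smul_eq_mul, arcBump, Complex.re_mul_ofReal]
      refine mul_nonneg ?_ (expNegInvGlue.nonneg _)
      rw [fourier_coe_two_pi, Complex.exp_ofReal_mul_I_re]
      have : |((-k : ℤ) : ℝ) * x| ≤ π / 2 := by
        rw [abs_mul]; push_cast; rw [abs_neg]
        exact (mul_le_mul_of_nonneg_left hx (abs_nonneg _)).trans hk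
      exact Real.cos_nonneg_of_mem_Icc ⟨(abs_le.1 this).1, (abs_le.1 this).2⟩
    · simp [arcBump_eq_zero hX]
  · have h1 : 0 < (1 : ℝ) - Real.cos δ := by
      have := Real.cos_lt_cos_of_nonneg_of_le_pi le_rfl hδ h0
      rw [Real.cos_zero] at this; linarith
    have := expNegInvGlue.pos_of_pos h1
    simpa [arcBump] using h1
end BenjaminOno

/-! ### Analysis at a fixed time. -/

namespace BenjaminOno
open AddCircle Topology

/-- If `f + i H f` is orthogonal to all translates, over an arc, of a function `g`, then the
positive Fourier coefficients of `f` vanish wherever the opposite ones of `g` do not. -/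
theorem fourierCoeff_eq_zero_of_integral_translates_eq_zero {f g : Torus → ℂ}
    (hf : MemLp f 2 haarAddCircle) (h0 : fourierCoeff f 0 = 0) (hg : SmoothOnTorus g)
    {s t : ℝ} (hst : s < t)
    (h : ∀ q : ℚ, (q : ℝ) ∈ Ioo s t →
      ∫ x, (f x + Complex.I * hilbert f x) * g (x - ((q : ℝ) : Torus)) ∂haarAddCircle = 0)
    {k : ℕ} (hk : fourierCoeff g (-k) ≠ 0) : fourierCoeff f k = 0 := by
  set c : ℕ → ℂ := fun n => fourierCoeff f n * fourierCoeff g (-n) with hc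
  have hcs : Summable fun n => ‖c n‖ :=
    (summable_norm_fourierCoeff_mul hf hg.memLp).comp_injective Nat.cast_injective
  suffices hck : c k = 0 from (mul_eq_zero.1 hck).resolve_right hk
  refine eq_zero_of_tsum_mul_pow_eq_zero_on_arc hcs hst ?_ k
  have hcont : Continuous fun x : ℝ => ∑' n, c n * Complex.exp (x * Complex.I) ^ n :=
    continuous_tsum (fun n => by fun_prop) hcs fun n x => by
      rw [norm_mul, norm_pow, Complex.norm_exp_ofReal_mul_I, one_pow, mul_one]
  have hF : MemLp (fun x => f x + Complex.I * hilbert f x) 2 haarAddCircle :=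
    hf.add ((Lp.memLp (hilbert f)).const_mul _)
  -- The multiplier `1 + sgn n` kills negative frequencies and doubles positive ones. At `n = 0` it
  -- is `1`, which is harmless because `f` has mean zero.
  have hFc : ∀ n : ℤ, fourierCoeff (fun x => f x + Complex.I * hilbert f x) n
      = (1 + (Int.sign n : ℂ)) * fourierCoeff f n := by
    intro n
    have e := congrFun (fourierCoeff.add (hf.integrable (by norm_num))
      (((Lp.memLp (hilbert f)).const_mul Complex.I).integrable (by norm_num))) n
    refine Eq.trans e ?_
    rw [Pi.add_apply, fourierCoeff.const_mul, fourierCoeff_hilbert hf]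
    linear_combination (-(Int.sign n : ℂ) * fourierCoeff f n) * Complex.I_mul_I
  have hq : ∀ q : ℚ, (q : ℝ) ∈ Ioo s t →
      ∑' n, c n * Complex.exp ((q : ℝ) * Complex.I) ^ n = 0 := by
    intro q hq
    have hs := hasSum_fourierCoeff_mul_fourierCoeff_neg hF (hg.comp_sub q).memLp
    rw [h q hq, ← Function.Injective.hasSum_iff Nat.cast_injective] at hs
    · have h2 := hs.tsum_eq
      have e : ∀ n : ℕ, fourierCoeff (fun x => f x + Complex.I * hilbert f x) (n : ℤ) *
          fourierCoeff (fun x => g (x - ((q : ℝ) : Torus))) (-n)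
          = 2 * (c n * Complex.exp ((q : ℝ) * Complex.I) ^ n) := by
        intro n
        rw [hFc, fourierCoeff_comp_sub, neg_neg, fourier_coe_two_pi, ← Complex.exp_nat_mul, hc]
        rcases Nat.eq_zero_or_pos n with rfl | hn
        · simp [h0]
        · rw [Int.sign_eq_one_of_pos (by exact_mod_cast hn)]
          push_cast
          rw [mul_assoc (n : ℂ)]
          ring
      simp only [Function.comp_def, e, tsum_mul_left] at h2
      exact (mul_eq_zero.1 h2).resolve_left two_ne_zero
    · intro n hn
      rw [hFc]
      have : n < 0 := by
        by_contra! h'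
        exact hn ⟨n.toNat, Int.toNat_of_nonneg h'⟩
      rw [Int.sign_eq_neg_one_of_neg this]
      simp
  have hcl : IsClosed {x : ℝ | ∑' n, c n * Complex.exp (x * Complex.I) ^ n = 0} :=
    isClosed_eq hcont continuous_const
  intro x hx
  -- The sum is continuous in the translation, so vanishing at the rationals of the interval
  -- suffices.
  have hd := Rat.denseRange_cast (𝕜 := ℝ) |>.open_subset_closure_inter isOpen_Ioo hx
  refine hcl.closure_subset_iff.2 ?_ hd
  rintro _ ⟨hy, q, rfl⟩
  exact hq q hy

theorem integral_circleDeriv_comp_sub {f : Torus → ℂ} (hf : SmoothOnTorus f) (y : Torus) :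
    ∫ x : Torus, circleDeriv f (x - y) = 0 := by
  have h := fourierCoeff_circleDeriv hf 0
  rw [fourierCoeff, integral_haarAddCircle] at h
  simp only [neg_zero, fourier_zero, one_smul, Int.cast_zero, mul_zero, zero_mul, smul_eq_zero,
    inv_eq_zero, Real.two_pi_pos.ne', false_or] at h
  rw [integral_sub_right_eq_self (circleDeriv f) y, h]

/-- The spatial integral in the weak formulation, tested with `η(t) χ'(x)` where `u` is constant
in space on the support of `χ`. -/
theorem integral_weak_formulation {f : Torus → ℝ} {g : Torus → ℂ}
    (hg : SmoothOnTorus g) {y c : ℝ}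
    {S : Set Torus} (hS : IsClosed S) (hgS : ∀ x ∉ S, g x = 0)
    (hfc : ∀ᵐ x : Torus, x - (y : Torus) ∈ S → f x = c) (ε α η η' : ℂ) :
    ∫ x : Torus, (-(f x : ℂ) * (η' * circleDeriv g (x - (y : Torus)))
        + (hilbert (fun x => (f x : ℂ)) x - ε * (f x : ℂ))
          * (η * circleDeriv (circleDeriv (circleDeriv g)) (x - (y : Torus)))
        - α * ((f x : ℂ) ^ 2 / 2) * (η * circleDeriv (circleDeriv g) (x - (y : Torus))))
      = η * ∫ x : Torus, hilbert (fun x => (f x : ℂ)) x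
          * circleDeriv (circleDeriv (circleDeriv g)) (x - (y : Torus)) := by
  have i1 := (hg.circleDeriv.comp_sub y).memLp.of_haarAddCircle.integrable (by norm_num)
  have i2 := (hg.circleDeriv.circleDeriv.comp_sub y).memLp.of_haarAddCircle.integrable (by norm_num)
  have i3 := (hg.circleDeriv.circleDeriv.circleDeriv.comp_sub y).memLp.of_haarAddCircle.integrable
    (by norm_num)
  have i4 : Integrable fun x : Torus => hilbert (fun x => (f x : ℂ)) x
      * circleDeriv (circleDeriv (circleDeriv g)) (x - (y : Torus)) :=
    MemLp.integrable_mul (Lp.memLp (hilbert fun x => (f x : ℂ))).of_haarAddCircle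
      (hg.circleDeriv.circleDeriv.circleDeriv.comp_sub y).memLp.of_haarAddCircle
  have z1 := circleDeriv_eq_zero_of_notMem hS hgS
  have z2 := circleDeriv_eq_zero_of_notMem hS z1
  have z3 := circleDeriv_eq_zero_of_notMem hS z2
  have key : (fun x : Torus => (-(f x : ℂ) * (η' * circleDeriv g (x - (y : Torus)))
        + (hilbert (fun x => (f x : ℂ)) x - ε * (f x : ℂ))
          * (η * circleDeriv (circleDeriv (circleDeriv g)) (x - (y : Torus)))
        - α * ((f x : ℂ) ^ 2 / 2) * (η * circleDeriv (circleDeriv g) (x - (y : Torus)))))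
      -- On `S` the function `f` may be replaced by `c`; off `S` all derivatives of `g` vanish. The
      -- local terms become constants times derivatives of `g`, with zero integral.
      =ᵐ[volume] fun x => η * (hilbert (fun x => (f x : ℂ)) x
          * circleDeriv (circleDeriv (circleDeriv g)) (x - (y : Torus)))
        + ((-c * η') * circleDeriv g (x - (y : Torus))
        + ((-ε * c * η) * circleDeriv (circleDeriv (circleDeriv g)) (x - (y : Torus))
        + (-α * (c ^ 2 / 2) * η) * circleDeriv (circleDeriv g) (x - (y : Torus)))) := by
    filter_upwards [hfc] with x hx
    by_cases hxS : x - (y : Torus) ∈ S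
    · rw [hx hxS]; ring
    · rw [z1 _ hxS, z2 _ hxS, z3 _ hxS]; ring
  rw [integral_congr_ae key, integral_add (i4.const_mul _), integral_add (i1.const_mul _),
    integral_add (i3.const_mul _) (i2.const_mul _)]
  rotate_left
  · exact (i3.const_mul _).add (i2.const_mul _)
  · exact (i1.const_mul _).add ((i3.const_mul _).add (i2.const_mul _))
  simp only [integral_const_mul]
  rw [integral_circleDeriv_comp_sub hg, integral_circleDeriv_comp_sub hg.circleDeriv,
    integral_circleDeriv_comp_sub hg.circleDeriv.circleDeriv]
  ring

end BenjaminOno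

/-! ### From the weak formulation to almost every time. -/

namespace BenjaminOno
open AddCircle Topology

theorem MemL2HZeroZero.memLp_prod {T : ℝ} {u : Torus → ℝ → ℝ} (hu : MemL2HZeroZero T u) :
    MemLp (fun p : Torus × ℝ => (u p.1 p.2 : ℂ)) 2 (volume.prod (volume.restrict (Ioo 0 T))) := by
  refine MemLp.ofReal ⟨hu.aestronglyMeasurable, ?_⟩
  have h := hu.lintegral_lt_top
  have e : ∀ {α : Type} [MeasurableSpace α] (μ : Measure α) (f : α → ℝ),
      eLpNorm f 2 μ ^ 2 = ∫⁻ x, ‖f x‖ₑ ^ 2 ∂μ := by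
    intro α _ μ f
    simpa using eLpNorm_nnreal_pow_eq_lintegral (f := f) (μ := μ) (p := 2) two_ne_zero
  simp only [e] at h
  rw [← lintegral_prod_symm (fun p : Torus × ℝ => ‖u p.1 p.2‖ₑ ^ 2)
    (hu.aestronglyMeasurable.enorm.pow_const 2), ← e] at h
  contrapose! h
  rw [top_le_iff] at h ⊢
  simp [h]

theorem MemHZeroZero.memLp_haarAddCircle {f : Torus → ℝ} (hf : MemHZeroZero f) :
    MemLp (fun x => (f x : ℂ)) 2 haarAddCircle :=
  (MemLp.ofReal hf.1).haarAddCircle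

theorem MemHZeroZero.fourierCoeff_zero {f : Torus → ℝ} (hf : MemHZeroZero f) :
    fourierCoeff (fun x => (f x : ℂ)) 0 = 0 := by
  have h : ∫ x, f x = 0 := (mul_eq_zero.1 hf.2).resolve_left (by positivity)
  rw [fourierCoeff, integral_haarAddCircle]
  simp only [neg_zero, fourier_zero, one_smul]
  rw [integral_complex_ofReal, h]
  simp

/-- The Hilbert transform of `u` paired with a fixed function is integrable in time. -/
theorem MemL2HZeroZero.integrable_integral_hilbert_mul {T : ℝ} {u : Torus → ℝ → ℝ}
    (hu : MemL2HZeroZero T u) {g : Torus → ℂ} (hg : MemLp g 2 haarAddCircle) :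
    Integrable (fun t => ∫ x : Torus, hilbert (fun y => (u y t : ℂ)) x * g x)
      (volume.restrict (Ioo 0 T)) := by
  -- Antisymmetry moves the Hilbert transform onto the time-independent `g`, so joint measurability
  -- of `Hu` is never needed.
  have hK := (Lp.memLp (hilbert g)).of_haarAddCircle
  have hint := (hu.memLp_prod.integrable_mul (hK.comp_fst (volume.restrict (Ioo 0 T)))).swap
  refine hint.integral_prod_left.neg.congr ?_
  filter_upwards [hu.memHZeroZero] with t ht
  have h := integral_hilbert_mul ht.memLp_haarAddCircle hg
  rw [integral_haarAddCircle, integral_haarAddCircle, ← smul_neg] at h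
  exact (smul_right_injective ℂ (inv_ne_zero Real.two_pi_pos.ne') h).symm

/-- Since `b ≤ a + 2π`, each point of the arc has a single representative in `(a, a + 2π]`, so the
null set on the line transfers to the circle. -/
theorem ae_eq_on_image_of_ae {T a b : ℝ} (hb : b ≤ a + 2 * π) {c : ℝ → ℝ} {u : Torus → ℝ → ℝ}
    (huc : ∀ᵐ p : ℝ × ℝ ∂((volume.restrict (Ioo a b)).prod (volume.restrict (Ioo 0 T))),
      u (p.1 : Torus) p.2 = c p.2) :
    ∀ᵐ t ∂(volume.restrict (Ioo 0 T)), ∀ᵐ X : Torus,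
      X ∈ ((↑) : ℝ → Torus) '' Ioo a b → u X t = c t := by
  have h := Measure.ae_ae_of_ae_prod
    ((Measure.measurePreserving_swap (μ := volume.restrict (Ioo 0 T))
      (ν := volume.restrict (Ioo a b))).quasiMeasurePreserving.ae huc)
  filter_upwards [h] with t ht
  refine ae_of_ae_restrict_Ioc (T := 2 * π) a ?_
  rw [ae_restrict_iff' measurableSet_Ioo] at ht
  rw [ae_restrict_iff' measurableSet_Ioc]
  filter_upwards [ht] with x hx hx1 ⟨y, hy, hyx⟩
  have hyI : y ∈ Ioc a (a + 2 * π) := ⟨hy.1, hy.2.le.trans hb⟩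
  have : y = x := congrArg Subtype.val
    ((equivIoc_coe_eq hyI).symm.trans ((congrArg _ hyx).trans (equivIoc_coe_eq hx1)))
  exact hx (this ▸ hy)

/-- Testing with `g'` rather than `g` removes the `u_t` term too: it becomes `-c(t) η'(t) ∫ g' = 0`,
with no regularity of `c` in time. -/
theorem ae_integral_hilbert_mul_eq_zero {α ε T a b : ℝ} (hb : b ≤ a + 2 * π)
    {c : ℝ → ℝ} {u : Torus → ℝ → ℝ} (hu : MemL2HZeroZero T u)
    (hsol : IsDistribSolution α ε T u)
    (huc : ∀ᵐ p : ℝ × ℝ ∂((volume.restrict (Ioo a b)).prod (volume.restrict (Ioo 0 T))),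
      u (p.1 : Torus) p.2 = c p.2)
    {g : Torus → ℂ} (hg : SmoothOnTorus g) {y : ℝ} {S : Set Torus} (hS : IsClosed S)
    (hgS : ∀ x ∉ S, g x = 0)
    (hSab : ∀ x : Torus, x - (y : Torus) ∈ S → x ∈ ((↑) : ℝ → Torus) '' Ioo a b) :
    ∀ᵐ t ∂(volume.restrict (Ioo 0 T)),
      ∫ x : Torus, ((u x t : ℂ) + Complex.I * hilbert (fun x => (u x t : ℂ)) x)
        * circleDeriv (circleDeriv (circleDeriv g)) (x - (y : Torus)) ∂haarAddCircle = 0 := by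
  have hg3 := hg.circleDeriv.circleDeriv.circleDeriv.comp_sub y
  have huc' := ae_eq_on_image_of_ae hb huc
  have hzero : ∀ᵐ t ∂(volume.restrict (Ioo 0 T)), t ∈ Ioo 0 T →
      ∫ x : Torus, hilbert (fun x => (u x t : ℂ)) x
        * circleDeriv (circleDeriv (circleDeriv g)) (x - (y : Torus)) = 0 := by
    -- Varying the time factor `η` localises the identity to a.e. `t`.
    refine isOpen_Ioo.ae_eq_zero_of_integral_contDiff_smul_eq_zero
      ((hu.integrable_integral_hilbert_mul hg3.memLp).locallyIntegrable.locallyIntegrableOn _) ?_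
    intro η hη hηc hηs
    have hd : ∀ t, HasDerivAt η (deriv η t) t := fun t =>
      ((hη.differentiable (by simp)) t).hasDerivAt
    have htest : IsTestFunction T fun x t => (η t : ℂ) * circleDeriv g (x - (y : Torus)) := by
      refine ⟨?_, tsupport η, hηc, hηs, fun x t ht => ?_⟩
      · have h1 : ContDiff ℝ ∞ fun p : ℝ × ℝ => (η p.2 : ℂ) :=
          Complex.ofRealCLM.contDiff.comp (hη.comp contDiff_snd)
        have h2 : ContDiff ℝ ∞ fun p : ℝ × ℝ => circleDeriv g ((p.1 : Torus) - (y : Torus)) :=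
          ContDiff.comp (g := fun x : ℝ => circleDeriv g ((x : Torus) - (y : Torus)))
            (hg.circleDeriv.comp_sub y) contDiff_fst
        exact h1.mul h2
      · simp [image_eq_zero_of_notMem_tsupport ht]
    rw [← hsol _ htest]
    refine integral_congr_ae ?_
    filter_upwards [huc'] with t ht
    have e1 : ∀ x : Torus, deriv (fun t => (η t : ℂ) * circleDeriv g (x - (y : Torus))) t
        = ((deriv η t : ℝ) : ℂ) * circleDeriv g (x - (y : Torus)) := fun x =>
      ((hd t).ofReal_comp.mul_const _).deriv
    have h := integral_weak_formulation (f := fun x => u x t) hg hS hgS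
      (ht.mono fun x hx hxS => hx (hSab x hxS)) ε α (η t) ((deriv η t : ℝ) : ℂ)
    rw [Complex.real_smul, ← h]
    simp only [e1, circleDeriv_const_mul, circleDeriv_comp_sub]
  filter_upwards [hzero, huc', hu.memHZeroZero, ae_restrict_mem measurableSet_Ioo]
    with t h1 h2 h3 h4
  have hc0 : ∫ x : Torus, (u x t : ℂ)
      * circleDeriv (circleDeriv (circleDeriv g)) (x - (y : Torus)) = 0 := by
    have z := circleDeriv_eq_zero_of_notMem hS (circleDeriv_eq_zero_of_notMem hS
      (circleDeriv_eq_zero_of_notMem hS hgS))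
    have : (fun x : Torus => (u x t : ℂ)
        * circleDeriv (circleDeriv (circleDeriv g)) (x - (y : Torus))) =ᵐ[volume]
        fun x => (c t : ℂ) * circleDeriv (circleDeriv (circleDeriv g)) (x - (y : Torus)) := by
      filter_upwards [h2] with x hx
      by_cases hxS : x - (y : Torus) ∈ S
      · rw [hx (hSab x hxS)]
      · rw [z _ hxS, mul_zero, mul_zero]
    rw [integral_congr_ae this, integral_const_mul,
      integral_circleDeriv_comp_sub hg.circleDeriv.circleDeriv, mul_zero]
  rw [integral_haarAddCircle]
  simp only [add_mul, mul_assoc]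
  rw [integral_add, integral_const_mul, hc0, h1 h4]
  · simp
  · exact h3.memLp_haarAddCircle.of_haarAddCircle.integrable_mul hg3.memLp.of_haarAddCircle
  · exact ((Lp.memLp (hilbert _)).of_haarAddCircle.integrable_mul
      hg3.memLp.of_haarAddCircle).const_mul _

end BenjaminOno

/-! ### Conclusion: all Fourier coefficients vanish. -/

open BenjaminOno AddCircle in
theorem proposition2p8 (α ε T a b : ℝ) (hε : 0 ≤ ε) (hT : 0 < T)
    (ha : 0 ≤ a) (hab : a < b) (hb : b ≤ 2 * π)
    (c : ℝ → ℝ) (hc : MemLp c 2 (volume.restrict (Ioo 0 T)))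
    (u : BenjaminOno.Torus → ℝ → ℝ) (hu : BenjaminOno.MemL2HZeroZero T u)
    (hsol : BenjaminOno.IsDistribSolution α ε T u)
    (huc : ∀ᵐ p : ℝ × ℝ ∂((volume.restrict (Ioo a b)).prod (volume.restrict (Ioo 0 T))),
      u (p.1 : BenjaminOno.Torus) p.2 = c p.2) :
    ∀ᵐ p : BenjaminOno.Torus × ℝ ∂((volume : Measure BenjaminOno.Torus).prod
      (volume.restrict (Ioo 0 T))), u p.1 p.2 = 0 := by
  have hπ := Real.pi_pos
  have hpos : ∀ᵐ t ∂(volume.restrict (Ioo 0 T)), ∀ k : ℕ, k ≠ 0 →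
      fourierCoeff (fun x : Torus => (u x t : ℂ)) k = 0 := by
    rw [ae_all_iff]
    intro k
    by_cases hk : k = 0
    · simp [hk]
    have hk0 : (0 : ℝ) < k := by exact_mod_cast Nat.pos_of_ne_zero hk
    -- The first bound makes the `-k`-th coefficient of the bump nonzero. The second keeps its
    -- translates by `q` in the middle half of `(a,b)` supported inside `(a,b)`.
    set δ : ℝ := min (π / 2 / k) ((b - a) / 8) with hδ
    have hδ0 : 0 < δ := lt_min (by positivity) (by linarith)
    have hδ1 : δ ≤ (b - a) / 8 := min_le_right _ _
    have hδk : (k : ℝ) * δ ≤ π / 2 := by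
      have := min_le_left (π / 2 / k) ((b - a) / 8)
      rw [le_div_iff₀ hk0] at this
      linarith
    have hcoef : fourierCoeff (circleDeriv (circleDeriv (circleDeriv (arcBump δ)))) (-k) ≠ 0 := by
      have hs := arcBump_smooth δ
      rw [fourierCoeff_circleDeriv hs.circleDeriv.circleDeriv,
        fourierCoeff_circleDeriv hs.circleDeriv, fourierCoeff_circleDeriv hs]
      have hI : Complex.I * ((-k : ℤ) : ℂ) ≠ 0 :=
        mul_ne_zero Complex.I_ne_zero (by simpa using hk)
      refine mul_ne_zero hI (mul_ne_zero hI (mul_ne_zero hI ?_))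
      exact fourierCoeff_arcBump_ne_zero hδ0 (by linarith) (by simpa using hδk)
    -- The exceptional set of times depends on the translation; restricting to rational ones leaves
    -- a countable union of null sets.
    have hq : ∀ᵐ t ∂(volume.restrict (Ioo 0 T)), ∀ q : ℚ,
        (q : ℝ) ∈ Ioo (a + (b - a) / 4) (b - (b - a) / 4) →
        ∫ x : Torus, ((u x t : ℂ) + Complex.I * hilbert (fun x => (u x t : ℂ)) x)
          * circleDeriv (circleDeriv (circleDeriv (arcBump δ))) (x - ((q : ℝ) : Torus))
            ∂haarAddCircle = 0 := by
      rw [ae_all_iff]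
      intro q
      by_cases hq : (q : ℝ) ∈ Ioo (a + (b - a) / 4) (b - (b - a) / 4)
      · simp only [hq, true_imp_iff]
        refine ae_integral_hilbert_mul_eq_zero (by linarith) hu hsol huc (arcBump_smooth δ)
          (isClosed_closedArc δ) (fun x => arcBump_eq_zero) fun X hX => ?_
        obtain ⟨x, hx, hxX⟩ := exists_mem_closedArc hδ0.le hX
        rw [abs_le] at hx
        refine ⟨x + q, ⟨by linarith [hq.1, hx.1], by linarith [hq.2, hx.2]⟩, ?_⟩
        rw [coe_add, hxX, sub_add_cancel]
      · simp [hq]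
    filter_upwards [hq, hu.memHZeroZero] with t ht hut _
    exact fourierCoeff_eq_zero_of_integral_translates_eq_zero hut.memLp_haarAddCircle
      hut.fourierCoeff_zero (arcBump_smooth δ).circleDeriv.circleDeriv.circleDeriv
      (by linarith) ht hcoef
  have hslice : ∀ᵐ t ∂(volume.restrict (Ioo 0 T)), ∀ᵐ x : Torus, u x t = 0 := by
    filter_upwards [hpos, hu.memHZeroZero] with t ht hut
    have hall : ∀ k : ℤ, fourierCoeff (fun x : Torus => (u x t : ℂ)) k = 0 := by
      have hnat : ∀ n : ℕ, fourierCoeff (fun x : Torus => (u x t : ℂ)) n = 0 := fun n => by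
        by_cases hn : n = 0
        · rw [hn]; exact hut.fourierCoeff_zero
        · exact ht n hn
      intro k
      obtain ⟨n, rfl | rfl⟩ := k.eq_nat_or_neg
      · exact hnat n
      · have := fourierCoeff_conj (fun x : Torus => (u x t : ℂ)) n
        simp only [Complex.conj_ofReal] at this
        rw [hnat n] at this
        simpa using this.symm
    have h := ae_eq_zero_of_fourierCoeff_eq_zero hut.memLp_haarAddCircle hall
    have hv : ∀ᵐ x : Torus, (u x t : ℂ) = 0 := by
      rw [volume_eq_smul_haarAddCircle]
      exact Measure.ae_smul_measure h _
    exact hv.mono fun x hx => by exact_mod_cast hx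
  -- Passing from slices to the product needs a measurable zero set, hence the strongly measurable
  -- representative `v`.
  have hmeas := hu.aestronglyMeasurable.prod_swap
  obtain ⟨v, hv, huv⟩ := hmeas
  have hprod : ∀ᵐ p : ℝ × Torus ∂((volume.restrict (Ioo 0 T)).prod volume), u p.2 p.1 = 0 := by
    have hv0 : ∀ᵐ p : ℝ × Torus ∂((volume.restrict (Ioo 0 T)).prod volume), v p = 0 := by
      rw [Measure.ae_prod_iff_ae_ae (measurableSet_eq_fun hv.measurable measurable_const)]
      filter_upwards [hslice, Measure.ae_ae_of_ae_prod huv] with t h1 h2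
      filter_upwards [h1, h2] with x h3 h4
      rw [← h4]
      exact h3
    filter_upwards [hv0, huv] with p h1 h2
    rw [← h1, ← h2]
    rfl
  exact Measure.measurePreserving_swap.quasiMeasurePreserving.ae hprod
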